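/- Let $q$ be a prime power, $F=\mathbb F_q$, let $d_1,\dots,d_r>0$ be integers with $d=\sum_{i=1}^r d_i$, and let $n$ be an integer with $1<n\mid q-1$ and $n\ge r$. Write $\mu_n$ for the group of complex $n$-th roots of unity and $G=GL_d(F)$. Let $X$ be the set of flags $V_1\subset V_2\subset\cdots\subset V_r=F^d$ of linear subspaces with $\dim V_i=\sum_{j\le i}d_j$, on which $g\in G$ acts through its natural action on $F^d$, and let $Y$ be the same set, on which $g\in G$ acts as $(g^{-1})^T$. Let $x_0\in X$ be the standard flag, in which $V_i$ is spanned by the first $\sum_{j\le i}d_j$ standard basis vectors, and let $y_0\in Y$ be the same flag regarded as a point of $Y$. Put $[m]_q=\frac{q^m-1}{q-1}$, $[m]_q!=[1]_q[2]_q\cdots[m]_q$, and $$N=\frac{[d]_q!}{[d_1]_q!\cdots[d_r]_q!},\qquad w=q^{\frac12\left(d^2-\sum_i d_i^2\right)}.$$ Then $|X|=|Y|=N$, and there is a matrix $A$ with rows indexed by $X$ and columns by $Y$ that is a generalized weighing matrix $GW(N,w;n)$, i.e. $0<w\le N$, all entries of $A$ lie in $\{0\}\cup\mu_n$, and $AA^*=wI$,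 such that: 1. the matrix $|A|$ of entrywise moduli is the characteristic matrix of the $G$-orbit of $(x_0,y_0)$ in $X\times Y$; 2. every element of the image of $G$ in $\mathrm{Perm}(X)\times\mathrm{Perm}(Y)$ preserves $|A|$ and lifts to an automorphism of $A$. Here an automorphism of $A$ is the class, modulo the pairs $(\zeta I,\zeta I)$ with $\zeta\in\mu_n$, of a pair $(L,R)$ of monomial matrices, indexed by $X$ and by $Y$ respectively, with nonzero entries in $\mu_n$, such that $LAR^*=A$; it lifts $(\sigma,\rho)$ if $|L|$ and $|R|$ are the permutation matrices of $\sigma$ and $\rho$. -/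

import Mathlib

noncomputable section

namespace FlagWeighing

/-! ### Generalized weighing matrices -/

/-- The set `μ_n⁺ = {0} ∪ μ_n` of complex numbers. -/
def muPlus (n : ℕ) : Set ℂ := {0} ∪ {z | ∃ ζ ∈ rootsOfUnity n ℂ, z = (ζ : ℂ)}

/-- `A` is a generalized weighing matrix `GW(N, w; n)`; rows are indexed by `X` and columns by `Y`,
both of cardinality `N`. -/
structure IsGW {X Y : Type*} [Fintype X] [Fintype Y] [DecidableEq X]
    (N w n : ℕ) (A : Matrix X Y ℂ) : Prop where
  weight_pos : 0 < w
  weight_le : w ≤ N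
  card_rows : Fintype.card X = N
  card_cols : Fintype.card Y = N
  entries : ∀ x y, A x y ∈ muPlus n
  mul_conjTranspose : A * A.conjTranspose = (w : ℂ) • (1 : Matrix X X ℂ)

/-- The entrywise modulus `|A|`. -/
def absMatrix {X Y : Type*} (A : Matrix X Y ℂ) : Matrix X Y ℝ := A.map (fun z => ‖z‖)

/-- The characteristic `0/1` matrix of a subset of `X × Y`. -/
def charMatrix {X Y : Type*} (O : Set (X × Y)) : Matrix X Y ℝ :=
  Matrix.of fun x y => O.indicator (fun _ => (1 : ℝ)) (x, y)

/-! ### Monomial matrices -/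

/-- A monomial matrix with values in `μ_n⁺`: each row and each column has a unique nonzero entry. -/
structure IsMonomial {S : Type*} (n : ℕ) (M : Matrix S S ℂ) : Prop where
  entries : ∀ i j, M i j ∈ muPlus n
  row : ∀ i, ∃! j, M i j ≠ 0
  col : ∀ j, ∃! i, M i j ≠ 0

theorem isMonomial_iff {S : Type*} [DecidableEq S] (n : ℕ) (M : Matrix S S ℂ) :
    IsMonomial n M ↔ ∃ (σ : Equiv.Perm S) (c : S → rootsOfUnity n ℂ),
      ∀ i j, M i j = if i = σ j then ((c j : ℂˣ) : ℂ) else 0 := by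
  constructor
  · intro h
    choose f hf hf' using h.row
    choose g hg hg' using h.col
    have hfg : ∀ j, f (g j) = j := fun j => (hf' _ _ (hg j)).symm
    have hgf : ∀ i, g (f i) = i := fun i => (hg' _ _ (hf i)).symm
    have hc : ∀ j, ∃ ζ : rootsOfUnity n ℂ, M (g j) j = ((ζ : ℂˣ) : ℂ) := by
      intro j
      rcases h.entries (g j) j with h0 | ⟨ζ, hζ, h1⟩
      · exact absurd h0 (hg j)
      · exact ⟨⟨ζ, hζ⟩, h1⟩
    choose c hc using hc
    refine ⟨⟨g, f, hfg, hgf⟩, c, fun i j => ?_⟩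
    by_cases hij : i = g j
    · subst hij; simp [hc]
    · have : M i j = 0 := by
        by_contra h0
        exact hij (hg' _ _ h0)
      simp [hij, this]
  · rintro ⟨σ, c, h⟩
    refine ⟨fun i j => ?_, fun i => ⟨σ.symm i, ?_, ?_⟩, fun j => ⟨σ j, ?_, ?_⟩⟩
    · rw [h]
      split_ifs
      · exact Or.inr ⟨c j, (c j).2, rfl⟩
      · exact Or.inl rfl
    · simp [h]
    · intro j hj
      have : i = σ j := by
        by_contra h0
        exact hj (by simp [h, h0])
      simp [this]
    · simp [h]
    · intro i hi
      by_contra h0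
      exact hi (by simp [h, h0])

/-- The group `Mon(S, μ_n)` of monomial matrices. -/
def Mon (n : ℕ) (S : Type*) [Fintype S] [DecidableEq S] : Subgroup (GL S ℂ) where
  carrier := {M | IsMonomial n (M : Matrix S S ℂ)}
  one_mem' := by
    refine (isMonomial_iff n _).2 ⟨1, 1, fun i j => ?_⟩
    by_cases h : i = j <;> simp [h]
  mul_mem' := by
    intro M N hM hN
    obtain ⟨σ, c, hσ⟩ := (isMonomial_iff n _).1 hM
    obtain ⟨τ, e, hτ⟩ := (isMonomial_iff n _).1 hN
    refine (isMonomial_iff n _).2 ⟨σ * τ, fun j => c (τ j) * e j, fun i j => ?_⟩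
    by_cases h : i = σ (τ j) <;> simp [Matrix.mul_apply, hσ, hτ, h]
  inv_mem' := by
    intro M hM
    obtain ⟨σ, c, hσ⟩ := (isMonomial_iff n _).1 hM
    refine (isMonomial_iff n _).2 ⟨σ⁻¹, fun j => (c (σ⁻¹ j))⁻¹, ?_⟩
    have key : (M : Matrix S S ℂ) * (Matrix.of fun i j =>
        if i = σ⁻¹ j then ((((c (σ⁻¹ j))⁻¹ : rootsOfUnity n ℂ) : ℂˣ) : ℂ) else 0) = 1 := by
      ext i j
      simp [Matrix.mul_apply, hσ, Matrix.one_apply]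
    have h2 := Units.inv_eq_of_mul_eq_one_right key
    intro i j
    rw [h2]
    rfl

/-- The permutation `|M|` underlying a monomial matrix `M`: the row of the nonzero entry of
each column. -/
def underlyingFun {n : ℕ} {S : Type*} [Fintype S] [DecidableEq S] (M : Mon n S) (j : S) : S :=
  (M.2.col j).choose

theorem underlyingFun_spec {n : ℕ} {S : Type*} [Fintype S] [DecidableEq S] (M : Mon n S)
    (i j : S) : (M : GL S ℂ) i j ≠ 0 ↔ i = underlyingFun M j := by
  constructor
  · intro h
    exact (M.2.col j).choose_spec.2 i h
  · rintro rfl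
    exact (M.2.col j).choose_spec.1

theorem underlyingFun_one {n : ℕ} {S : Type*} [Fintype S] [DecidableEq S] (j : S) :
    underlyingFun (1 : Mon n S) j = j := by
  symm
  rw [← underlyingFun_spec]
  simp

theorem underlyingFun_mul {n : ℕ} {S : Type*} [Fintype S] [DecidableEq S] (M N : Mon n S) (j : S) :
    underlyingFun (M * N) j = underlyingFun M (underlyingFun N j) := by
  symm
  rw [← underlyingFun_spec]
  have h : ((M * N : Mon n S) : GL S ℂ) (underlyingFun M (underlyingFun N j)) j =
      (M : GL S ℂ) (underlyingFun M (underlyingFun N j)) (underlyingFun N j) *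
        (N : GL S ℂ) (underlyingFun N j) j := by
    simp only [Subgroup.coe_mul, Units.val_mul, Matrix.mul_apply]
    refine Finset.sum_eq_single _ (fun k _ hk => ?_) (by simp)
    have : (N : GL S ℂ) k j = 0 := by
      by_contra h0
      exact hk ((underlyingFun_spec N k j).1 h0)
    simp [this]
  rw [h]
  exact mul_ne_zero ((underlyingFun_spec _ _ _).2 rfl) ((underlyingFun_spec _ _ _).2 rfl)

/-- The homomorphism `M ↦ |M|` from monomial matrices to permutations; a permutation `σ` is
identified with the permutation matrix whose `(i, j)` entry is `1` exactly if `i = σ j`. -/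
def absMon (n : ℕ) (S : Type*) [Fintype S] [DecidableEq S] : Mon n S →* Equiv.Perm S where
  toFun M :=
    { toFun := underlyingFun M
      invFun := underlyingFun M⁻¹
      left_inv := fun j => by
        rw [← underlyingFun_mul, inv_mul_cancel, underlyingFun_one]
      right_inv := fun j => by
        rw [← underlyingFun_mul, mul_inv_cancel, underlyingFun_one] }
  map_one' := Equiv.ext underlyingFun_one
  map_mul' M N := Equiv.ext (underlyingFun_mul M N)

/-- The scalar matrix `ζ I` as a monomial matrix. -/
def scalarMon (n : ℕ) (S : Type*) [Fintype S] [DecidableEq S] : rootsOfUnity n ℂ →* Mon n S where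
  toFun ζ := ⟨Units.map (algebraMap ℂ (Matrix S S ℂ)).toMonoidHom (ζ : ℂˣ), by
    refine (isMonomial_iff n _).2 ⟨1, fun _ => ζ, fun i j => ?_⟩
    by_cases h : i = j <;> simp [Matrix.algebraMap_matrix_apply, h]⟩
  map_one' := by ext; simp
  map_mul' ζ ξ := by ext; simp

theorem absMon_scalarMon (n : ℕ) (S : Type*) [Fintype S] [DecidableEq S] (ζ : rootsOfUnity n ℂ) :
    absMon n S (scalarMon n S ζ) = 1 := by
  refine Equiv.ext fun j => ?_
  symm
  change j = underlyingFun (scalarMon n S ζ) j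
  rw [← underlyingFun_spec]
  simp [scalarMon, Matrix.algebraMap_matrix_apply]

/-! ### Automorphism groups -/

/-- The group `Triv` of pairs `(ζ I, ζ I)`, `ζ ∈ μ_n`. -/
def Triv (n : ℕ) (X Y : Type*) [Fintype X] [DecidableEq X] [Fintype Y] [DecidableEq Y] :
    Subgroup (Mon n X × Mon n Y) :=
  ((scalarMon n X).prod (scalarMon n Y)).range

instance (n : ℕ) (X Y : Type*) [Fintype X] [DecidableEq X] [Fintype Y] [DecidableEq Y] :
    (Triv n X Y).Normal := by
  refine ⟨?_⟩
  rintro _ ⟨ζ, rfl⟩ g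
  have h : g * ((scalarMon n X).prod (scalarMon n Y)) ζ * g⁻¹ =
      ((scalarMon n X).prod (scalarMon n Y)) ζ := by
    rw [mul_inv_eq_iff_eq_mul]
    refine Prod.ext (Subtype.ext (Units.ext ?_)) (Subtype.ext (Units.ext ?_))
    · exact (Algebra.commutes (((ζ : ℂˣ) : ℂ)) ((g.1 : GL X ℂ) : Matrix X X ℂ)).symm
    · exact (Algebra.commutes (((ζ : ℂˣ) : ℂ)) ((g.2 : GL Y ℂ) : Matrix Y Y ℂ)).symm
  rw [h]
  exact ⟨ζ, rfl⟩

/-- The group of all pairs `(L, R)` of monomial matrices with `L A R^* = A`. -/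
def AutPre {X Y : Type*} [Fintype X] [DecidableEq X] [Fintype Y] [DecidableEq Y]
    (n : ℕ) (A : Matrix X Y ℂ) : Subgroup (Mon n X × Mon n Y) where
  carrier := {p | ((p.1 : GL X ℂ) : Matrix X X ℂ) * A *
    ((p.2 : GL Y ℂ) : Matrix Y Y ℂ).conjTranspose = A}
  one_mem' := by simp
  mul_mem' := by
    intro p r hp hr
    simp only [Set.mem_ofPred_eq, Prod.fst_mul, Prod.snd_mul, Subgroup.coe_mul, Units.val_mul,
      Matrix.conjTranspose_mul] at hp hr ⊢
    nth_rewrite 2 [← hp]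
    nth_rewrite 2 [← hr]
    simp only [Matrix.mul_assoc]
  inv_mem' := by
    intro p hp
    simp only [Set.mem_ofPred_eq, Prod.fst_inv, Prod.snd_inv, Subgroup.coe_inv] at hp ⊢
    have h1 : (((p.1 : GL X ℂ)⁻¹ : GL X ℂ) : Matrix X X ℂ) * ((p.1 : GL X ℂ) : Matrix X X ℂ) = 1 :=
      Units.inv_mul _
    have h2 : ((p.2 : GL Y ℂ) : Matrix Y Y ℂ).conjTranspose *
        (((p.2 : GL Y ℂ)⁻¹ : GL Y ℂ) : Matrix Y Y ℂ).conjTranspose = 1 := by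
      rw [← Matrix.conjTranspose_mul, Units.inv_mul, Matrix.conjTranspose_one]
    nth_rewrite 1 [← hp]
    rw [← Matrix.mul_assoc, ← Matrix.mul_assoc, h1, Matrix.one_mul, Matrix.mul_assoc, h2,
      Matrix.mul_one]

/-- The automorphism group `Aut(A)`, a subgroup of `(Mon(X, μ_n) × Mon(Y, μ_n)) / Triv`. -/
def Aut {X Y : Type*} [Fintype X] [DecidableEq X] [Fintype Y] [DecidableEq Y]
    (n : ℕ) (A : Matrix X Y ℂ) : Subgroup ((Mon n X × Mon n Y) ⧸ Triv n X Y) :=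
  (AutPre n A).map (QuotientGroup.mk' (Triv n X Y))

/-- The homomorphism `(L, R) ↦ (|L|, |R|)` on `(Mon(X, μ_n) × Mon(Y, μ_n)) / Triv`; its restriction
to `Aut(A)` is the natural homomorphism `Aut(A) → PermAut(|A|)`. -/
def absPair (n : ℕ) (X Y : Type*) [Fintype X] [DecidableEq X] [Fintype Y] [DecidableEq Y] :
    (Mon n X × Mon n Y) ⧸ Triv n X Y →* Equiv.Perm X × Equiv.Perm Y :=
  QuotientGroup.lift (Triv n X Y) ((absMon n X).prodMap (absMon n Y)) (by
    rintro _ ⟨ζ, rfl⟩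
    exact Prod.ext (absMon_scalarMon n X ζ) (absMon_scalarMon n Y ζ))

/-- The group `PermAut(Z)` of pairs of permutations of the rows and columns that preserve `Z`. -/
def PermAut {X Y : Type*} (Z : Matrix X Y ℝ) : Subgroup (Equiv.Perm X × Equiv.Perm Y) where
  carrier := {p | ∀ x y, Z (p.1 x) (p.2 y) = Z x y}
  one_mem' := fun _ _ => rfl
  mul_mem' := by
    intro p r hp hr x y
    exact (hp _ _).trans (hr x y)
  inv_mem' := by
    intro p hp x y
    have := hp (p.1⁻¹ x) (p.2⁻¹ y)
    simpa using this.symm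

/-! ### Flag varieties -/

/-- A flag of type `(P 0, …, P (r - 1))` in `F^d`: an increasing sequence of subspaces, the `i`-th
one of dimension `∑ j ≤ i, P j`. When `r > 0` and `∑ i, P i = d`, the last one is `F^d`. -/
@[ext]
structure Flag (F : Type*) [Field F] (d : ℕ) {r : ℕ} (P : Fin r → ℕ) where
  space : Fin r → Submodule F (Fin d → F)
  mono : Monotone space
  finrank_space : ∀ i, Module.finrank F (space i) = ∑ j ∈ Finset.Iic i, P j

instance (F : Type*) [Field F] [Fintype F] (d : ℕ) {r : ℕ} (P : Fin r → ℕ) :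
    Finite (Flag F d P) :=
  Finite.of_injective (fun x : Flag F d P => x.space) fun _ _ h => Flag.ext h

instance (F : Type*) [Field F] [Fintype F] (d : ℕ) {r : ℕ} (P : Fin r → ℕ) :
    Fintype (Flag F d P) := Fintype.ofFinite _

instance (F : Type*) [Field F] (d : ℕ) {r : ℕ} (P : Fin r → ℕ) :
    DecidableEq (Flag F d P) := Classical.decEq _

/-- `GL_d(F)` acts on flags through its action on column vectors. -/
instance (F : Type*) [Field F] (d : ℕ) {r : ℕ} (P : Fin r → ℕ) :
    MulAction (GL (Fin d) F) (Flag F d P) where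
  smul g x :=
    { space := fun i => (x.space i).map (Matrix.mulVecLin (g : Matrix (Fin d) (Fin d) F))
      mono := fun _ _ h => Submodule.map_mono (x.mono h)
      finrank_space := fun i => by
        have hg : Function.Injective (Matrix.mulVecLin g.val) :=
          Matrix.mulVec_injective_iff_isUnit.2 g.isUnit
        rw [← x.finrank_space i]
        exact (Submodule.equivMapOfInjective _ hg (x.space i)).finrank_eq.symm }
  one_smul x := by
    refine Flag.ext (funext fun i => ?_)
    change (x.space i).map (Matrix.mulVecLin ((1 : GL (Fin d) F) : Matrix (Fin d) (Fin d) F)) = _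
    rw [Units.val_one, Matrix.mulVecLin_one, Submodule.map_id]
  mul_smul g h x := by
    refine Flag.ext (funext fun i => ?_)
    change (x.space i).map (Matrix.mulVecLin ((g * h : GL (Fin d) F) : Matrix (Fin d) (Fin d) F)) =
      ((x.space i).map (Matrix.mulVecLin (h : Matrix (Fin d) (Fin d) F))).map
        (Matrix.mulVecLin (g : Matrix (Fin d) (Fin d) F))
    rw [Units.val_mul, Matrix.mulVecLin_mul, Submodule.map_comp]

/-- The automorphism `g ↦ (g⁻¹)ᵀ` of `GL_d(F)`. -/
def contragredient (F : Type*) [Field F] (d : ℕ) : GL (Fin d) F →* GL (Fin d) F where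
  toFun g :=
    { val := ((g⁻¹ : GL (Fin d) F) : Matrix (Fin d) (Fin d) F).transpose
      inv := (g : Matrix (Fin d) (Fin d) F).transpose
      val_inv := by rw [← Matrix.transpose_mul, Units.mul_inv, Matrix.transpose_one]
      inv_val := by rw [← Matrix.transpose_mul, Units.inv_mul, Matrix.transpose_one] }
  map_one' := by
    refine Units.ext ?_
    change ((1⁻¹ : GL (Fin d) F) : Matrix (Fin d) (Fin d) F).transpose = 1
    rw [inv_one, Units.val_one, Matrix.transpose_one]
  map_mul' g h := by
    refine Units.ext ?_
    change (((g * h)⁻¹ : GL (Fin d) F) : Matrix (Fin d) (Fin d) F).transpose =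
      ((g⁻¹ : GL (Fin d) F) : Matrix (Fin d) (Fin d) F).transpose *
        ((h⁻¹ : GL (Fin d) F) : Matrix (Fin d) (Fin d) F).transpose
    rw [mul_inv_rev, Units.val_mul, Matrix.transpose_mul]

/-- The dual flag variety: the same set of flags, on which `g` acts as `(g⁻¹)ᵀ`. -/
def DualFlag (F : Type*) [Field F] (d : ℕ) {r : ℕ} (P : Fin r → ℕ) := Flag F d P

instance (F : Type*) [Field F] [Fintype F] (d : ℕ) {r : ℕ} (P : Fin r → ℕ) :
    Fintype (DualFlag F d P) := inferInstanceAs (Fintype (Flag F d P))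

instance (F : Type*) [Field F] (d : ℕ) {r : ℕ} (P : Fin r → ℕ) :
    DecidableEq (DualFlag F d P) := inferInstanceAs (DecidableEq (Flag F d P))

instance (F : Type*) [Field F] (d : ℕ) {r : ℕ} (P : Fin r → ℕ) :
    MulAction (GL (Fin d) F) (DualFlag F d P) :=
  MulAction.compHom (Flag F d P) (contragredient F d)

/-- The standard flag: the `i`-th space is spanned by the first `∑ j ≤ i, P j` standard vectors. -/
def standardFlag (F : Type*) [Field F] (d : ℕ) {r : ℕ} (P : Fin r → ℕ) (hd : ∑ i, P i = d) :
    Flag F d P where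
  space i := Submodule.span F
    ((fun k : Fin d => (Pi.single k 1 : Fin d → F)) '' {k | (k : ℕ) < ∑ j ∈ Finset.Iic i, P j})
  mono i i' h := by
    refine Submodule.span_mono (Set.image_mono fun (k : Fin d) hk => ?_)
    exact lt_of_lt_of_le (show (k : ℕ) < _ from hk)
      (Finset.sum_le_sum_of_subset (Finset.Iic_subset_Iic.2 h))
  finrank_space i := by
    have hle : ∑ j ∈ Finset.Iic i, P j ≤ d := by
      rw [← hd]
      exact Finset.sum_le_sum_of_subset (Finset.subset_univ _)
    have hli : LinearIndependent F (fun k : Fin d => (Pi.single k 1 : Fin d → F)) := by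
      have := (Pi.basisFun F (Fin d)).linearIndependent
      have he : ⇑(Pi.basisFun F (Fin d)) = fun k : Fin d => (Pi.single k 1 : Fin d → F) :=
        funext fun k => Pi.basisFun_apply F (Fin d) k
      rwa [he] at this
    rw [Set.image_eq_range]
    refine (finrank_span_eq_card (hli.comp _ Subtype.val_injective)).trans ?_
    refine (Fintype.card_congr (β := Fin (∑ j ∈ Finset.Iic i, P j)) ?_).trans (Fintype.card_fin _)
    exact
      { toFun := fun k => ⟨k.1, k.2⟩
        invFun := fun k => ⟨⟨k.1, lt_of_lt_of_le k.2 hle⟩, k.2⟩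
        left_inv := fun _ => rfl
        right_inv := fun _ => rfl }

/-- The standard flag as a point of the dual flag variety. -/
def dualStandardFlag (F : Type*) [Field F] (d : ℕ) {r : ℕ} (P : Fin r → ℕ)
    (hd : ∑ i, P i = d) : DualFlag F d P := standardFlag F d P hd

/-- The pair of permutations by which `g` acts on the flag variety and on its dual. -/
def flagPerm (F : Type*) [Field F] (d : ℕ) {r : ℕ} (P : Fin r → ℕ) :
    GL (Fin d) F →* Equiv.Perm (Flag F d P) × Equiv.Perm (DualFlag F d P) :=
  (MulAction.toPermHom (GL (Fin d) F) (Flag F d P)).prod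
    (MulAction.toPermHom (GL (Fin d) F) (DualFlag F d P))

/-! ### Gaussian multinomial coefficients -/

/-- `[m]_q = (q^m - 1) / (q - 1)`. -/
def qNumber (q m : ℕ) : ℚ := ((q : ℚ) ^ m - 1) / ((q : ℚ) - 1)

/-- `[m]_q! = [1]_q [2]_q ⋯ [m]_q`. -/
def qFactorial (q m : ℕ) : ℚ := ∏ k ∈ Finset.Icc 1 m, qNumber q k

/-- The Gaussian multinomial coefficient `[d]_q! / ∏ i, [P i]_q!`. -/
def qMultinomial (q d : ℕ) {r : ℕ} (P : Fin r → ℕ) : ℚ :=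
  qFactorial q d / ∏ i, qFactorial q (P i)

end FlagWeighing

end

/-!
A flag and a dual flag are in general position when, for bases adapted to them, all leading block
minors of the matrix of their pairing are nonzero. Let `χ` be a character of `Fˣ` of order `n`,
extended by `0`. The matrix `flagMatrix` has as entry at a pair of flags the product of the values
of `χ` at all these leading block minors, for a fixed choice of adapted bases (`frame`).

Replacing the bases multiplies the pairing matrix by block triangular matrices on both sides, which
multiplies each leading block minor by a minor that depends only on the row and by one that depends
only on the column (`leadingMinor_mul`, `leadingMinor_transpose_mul`). Hence an element `g` of
`GL_d(F)` changes the entries by row and column factors in `μ_n` (`flagMatrix_eq_smul`), that is, it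
lifts to an automorphism (`exists_mem_Aut`). By the block LU decomposition
(`exists_blockTriangular_factorization`) the support of the matrix is a single orbit
(`flagMatrix_ne_zero_iff`).

Two distinct rows `x`, `x'` are orthogonal (`flagMatrix_row_orthogonal`): reindexing their inner
product by a `g` that fixes both flags shows that it equals itself times the ratio of the two row
factors, and this ratio can be made different from `1`: there is a `g`, multiplying one vector by
`t` and fixing a complementary hyperplane, whose row factors are powers of `χ t` with distinct
exponents between `1` and `r` (`exists_dilation`). Since `r ≤ n`, the exponents differ modulo `n`.

The numbers `N` and `w` follow from the orbit-stabilizer theorem: the stabilizer of the standard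
flag consists of the invertible block triangular matrices, that of the pair of standard flags of the
block diagonal ones, and both are counted by `card_GL_supported`.
-/

noncomputable section

namespace FlagWeighing

open Matrix

/-! ### Leading block minors -/

section Minors

variable {m α K : Type*} [Fintype m] [DecidableEq m] [LinearOrder α] [Field K]

/-- The leading principal block minor of `M` at level `i`: the determinant of the submatrix on the
indices whose block is at most `i`. -/
def leadingMinor (b : m → α) (M : Matrix m m K) (i : α) : K :=
  (M.toSquareBlockProp fun k => b k ≤ i).det

theorem leadingMinor_one (b : m → α) (i : α) : leadingMinor b (1 : Matrix m m K) i = 1 := by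
  have : (1 : Matrix m m K).toSquareBlockProp (fun k => b k ≤ i) = 1 :=
    Matrix.submatrix_one _ Subtype.val_injective
  rw [leadingMinor, this, det_one]

theorem leadingMinor_transpose (b : m → α) (M : Matrix m m K) (i : α) :
    leadingMinor b Mᵀ i = leadingMinor b M i :=
  det_transpose (M.toSquareBlockProp fun k => b k ≤ i)

theorem leadingMinor_mul (b : m → α) (M : Matrix m m K) {N : Matrix m m K}
    (hN : N.BlockTriangular b) (i : α) :
    leadingMinor b (M * N) i = leadingMinor b M i * leadingMinor b N i := by
  rw [leadingMinor, leadingMinor, leadingMinor, ← det_mul]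
  congr 1
  ext k l
  rw [toSquareBlockProp_def, of_apply, mul_apply, mul_apply]
  refine (Finset.sum_subset (Finset.filter_subset (fun j => b j ≤ i) _) ?_).symm.trans ?_
  · intro j _ hj
    have hij : i < b j := by simpa using hj
    rw [hN (lt_of_le_of_lt l.2 hij), mul_zero]
  · rw [Finset.sum_subtype _ (p := fun j => b j ≤ i) (by simp)]
    rfl

theorem leadingMinor_transpose_mul (b : m → α) {p : Matrix m m K} (hp : p.BlockTriangular b)
    (M : Matrix m m K) (i : α) :
    leadingMinor b (pᵀ * M) i = leadingMinor b p i * leadingMinor b M i := by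
  rw [← leadingMinor_transpose, transpose_mul, transpose_transpose, leadingMinor_mul b _ hp,
    leadingMinor_transpose, mul_comm]

theorem blockTriangular_inv {b : m → α} {p : GL m K}
    (hp : (p : Matrix m m K).BlockTriangular b) :
    ((p⁻¹ : GL m K) : Matrix m m K).BlockTriangular b := by
  rw [coe_units_inv]
  let _ := p.isUnit.invertible
  exact blockTriangular_inv_of_blockTriangular hp

theorem leadingMinor_ne_zero {b : m → α} {p : GL m K}
    (hp : (p : Matrix m m K).BlockTriangular b) (i : α) :
    leadingMinor b (p : Matrix m m K) i ≠ 0 := by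
  have h := leadingMinor_mul b (p : Matrix m m K) (blockTriangular_inv hp) i
  rw [← Units.val_mul, mul_inv_cancel, Units.val_one, leadingMinor_one] at h
  exact left_ne_zero_of_mul (h ▸ one_ne_zero)

/-- Leading block minors of a rank one perturbation of the identity. -/
theorem leadingMinor_one_add_vecMulVec (b : m → α) (v w : m → K) (i : α) :
    leadingMinor b (1 + vecMulVec v w) i = 1 + ∑ k with b k ≤ i, w k * v k := by
  have h : (1 + vecMulVec v w).toSquareBlockProp (fun k => b k ≤ i) =
      1 + replicateCol Unit (fun k : {k // b k ≤ i} => v k) *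
        replicateRow Unit (fun k : {k // b k ≤ i} => w k) := by
    ext k l
    simp [toSquareBlockProp_def, vecMulVec_apply, one_apply, Subtype.ext_iff, mul_apply]
  rw [leadingMinor, h, det_one_add_replicateCol_mul_replicateRow, dotProduct]
  congr 1
  exact (Finset.sum_subtype _ (by simp) (fun k => w k * v k)).symm

/-- Block LU decomposition. The `l`-th column of the inverse of the upper factor is obtained by
solving `M z = e_l` within the leading block that ends with the block of `l`. -/
theorem exists_blockTriangular_factorization [Fintype α] (b : m → α) {M : Matrix m m K}
    (hM : ∀ i, leadingMinor b M i ≠ 0) :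
    ∃ p p' : GL m K, (p : Matrix m m K).BlockTriangular b ∧
      (p' : Matrix m m K).BlockTriangular b ∧ M = (p : Matrix m m K)ᵀ * (p' : Matrix m m K) := by
  let B : ∀ i, Matrix {k // b k ≤ i} {k // b k ≤ i} K := fun i =>
    M.toSquareBlockProp fun k => b k ≤ i
  have hB : ∀ i, B i * (B i)⁻¹ = 1 := fun i => mul_nonsing_inv _ (isUnit_iff_ne_zero.2 (hM i))
  let Z : Matrix m m K := of fun k l =>
    if h : b k ≤ b l then (B (b l))⁻¹ ⟨k, h⟩ ⟨l, le_rfl⟩ else 0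
  have hZ : Z.BlockTriangular b := fun k l h => dif_neg (not_le.2 h)
  have hMZ : ∀ k l, b k ≤ b l → (M * Z) k l = (1 : Matrix m m K) k l := by
    intro k l h
    have h1 := congrFun (congrFun (hB (b l)) ⟨k, h⟩) ⟨l, le_rfl⟩
    rw [mul_apply, one_apply] at h1
    rw [mul_apply, one_apply]
    simp only [Subtype.mk.injEq] at h1
    rw [← h1]
    refine (Finset.sum_subset (Finset.filter_subset (fun j => b j ≤ b l) _) ?_).symm.trans ?_
    · intro j _ hj
      have : ¬ b j ≤ b l := by simpa using hj
      simp [Z, this]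
    · rw [Finset.sum_subtype _ (p := fun j => b j ≤ b l) (by simp)]
      refine Finset.sum_congr rfl fun j _ => ?_
      simp only [Z, of_apply, dif_pos j.2]
      rfl
  have hQ : (M * Z)ᵀ.BlockTriangular b := fun k l h => by
    rw [transpose_apply, hMZ _ _ h.le, one_apply_ne (fun e => h.ne (congrArg b e))]
  have hdet : (M * Z).det = 1 := by
    rw [← det_transpose, hQ.det_fintype]
    refine Finset.prod_eq_one fun i _ => ?_
    have : (M * Z)ᵀ.toSquareBlock b i = 1 := by
      ext k l
      simp only [toSquareBlock_def, of_apply, transpose_apply]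
      rw [hMZ _ _ (by rw [k.2, l.2]), one_apply, one_apply]
      simp [Subtype.ext_iff, eq_comm]
    rw [this, det_one]
  have hZdet : Z.det ≠ 0 := fun h => by
    rw [det_mul, h, mul_zero] at hdet
    exact zero_ne_one hdet
  let z : GL m K := GeneralLinearGroup.mkOfDetNeZero Z hZdet
  let p : GL m K := GeneralLinearGroup.mkOfDetNeZero (M * Z)ᵀ
    (by rw [det_transpose, hdet]; exact one_ne_zero)
  refine ⟨p, z⁻¹, hQ, blockTriangular_inv (p := z) hZ, ?_⟩
  have hz : Z * ((z⁻¹ : GL m K) : Matrix m m K) = 1 := Units.mul_inv z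
  change M = (M * Z)ᵀᵀ * _
  rw [transpose_transpose, Matrix.mul_assoc, hz, Matrix.mul_one]

/-! ### Counting invertible block triangular matrices -/

/-- Block triangular matrices with prescribed zeros off the diagonal blocks: the pairs in `T` are
the off-diagonal positions where an entry may be nonzero. Such a matrix is a free choice of
invertible diagonal blocks and of entries at the positions in `T`. -/
theorem card_GL_supported [Fintype α] [Fintype K] (b : m → α) (T : m → m → Prop)
    (hT : ∀ k l, T k l → b k < b l) :
    Nat.card {g : GL m K // ∀ k l, b k ≠ b l → ¬ T k l → g k l = 0} =
      (∏ i, Nat.card (GL {k // b k = i} K)) *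
        Fintype.card K ^ Nat.card {x : m × m // T x.1 x.2} := by
  classical
  have hbt : ∀ M : Matrix m m K, (∀ k l, b k ≠ b l → ¬ T k l → M k l = 0) →
      M.BlockTriangular b := fun M h k l hkl =>
    h k l hkl.ne' fun ht => hkl.asymm (hT _ _ ht)
  let build : (∀ i, Matrix {k // b k = i} {k // b k = i} K) → ({x : m × m // T x.1 x.2} → K) →
      Matrix m m K := fun D f => of fun k l =>
    if h : b k = b l then D (b l) ⟨k, h⟩ ⟨l, rfl⟩ else if h : T k l then f ⟨(k, l), h⟩ else 0
  have hblock : ∀ D f i, (build D f).toSquareBlock b i = D i := by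
    intro D f i
    ext ⟨k, hk⟩ ⟨l, rfl⟩
    simp [build, toSquareBlock_def, hk]
  have hsupp : ∀ D f k l, b k ≠ b l → ¬ T k l → build D f k l = 0 := by
    intro D f k l h1 h2
    simp [build, h1, h2]
  have hdet : ∀ D f, (build D f).det = ∏ i, (D i).det := by
    intro D f
    rw [(hbt _ (hsupp D f)).det_fintype]
    simp_rw [hblock]
  let e : {g : GL m K // ∀ k l, b k ≠ b l → ¬ T k l → g k l = 0} ≃
      (∀ i, GL {k // b k = i} K) × ({x : m × m // T x.1 x.2} → K) :=
    { toFun := fun g =>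
        (fun i => GeneralLinearGroup.mkOfDetNeZero ((g.1 : Matrix m m K).toSquareBlock b i) (by
          have h := g.1.isUnit
          rw [isUnit_iff_isUnit_det, isUnit_iff_ne_zero, (hbt _ g.2).det_fintype] at h
          exact Finset.prod_ne_zero_iff.1 h i (Finset.mem_univ i)), fun x => g.1 x.1.1 x.1.2)
      invFun := fun D => ⟨GeneralLinearGroup.mkOfDetNeZero
        (build (fun i => (D.1 i : Matrix {k // b k = i} {k // b k = i} K)) D.2) (by
          refine (hdet (fun i => (D.1 i).val) D.2).trans_ne (Finset.prod_ne_zero_iff.2 fun i _ => ?_)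
          have h := (D.1 i).isUnit
          rwa [isUnit_iff_isUnit_det, isUnit_iff_ne_zero] at h),
        fun k l h1 h2 => hsupp (fun i => (D.1 i).val) D.2 k l h1 h2⟩
      left_inv := fun g => by
        refine Subtype.ext (Units.ext (Matrix.ext fun k l => ?_))
        change build (fun i => (g.1 : Matrix m m K).toSquareBlock b i)
          (fun x => g.1 x.1.1 x.1.2) k l = g.1 k l
        by_cases h1 : b k = b l
        · simp only [build, of_apply, dif_pos h1]
          rfl
        · by_cases h2 : T k l
          · simp [build, h1, h2]
          · exact (hsupp (fun i => (g.1 : Matrix m m K).toSquareBlock b i) (fun x => g.1 x.1.1 x.1.2)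
              k l h1 h2).trans (g.2 k l h1 h2).symm
      right_inv := fun D => by
        refine Prod.ext (funext fun i => Units.ext
          (hblock (fun i => (D.1 i).val) D.2 i)) (funext fun x => ?_)
        change build (fun i => (D.1 i).val) D.2 x.1.1 x.1.2 = _
        simp [build, (hT _ _ x.2).ne, x.2] }
  rw [Nat.card_congr e, Nat.card_prod, Nat.card_pi, Nat.card_fun, Nat.card_eq_fintype_card (α := K)]

end Minors

/-! ### The block function of a composition -/

section Block

variable {d r : ℕ} {P : Fin r → ℕ}

/-- The index set `Fin d` divided into consecutive blocks of sizes `P 0, …, P (r - 1)`. -/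
def blockEquiv (hd : ∑ i, P i = d) : (Σ i, Fin (P i)) ≃ Fin d :=
  finSigmaFinEquiv.trans (finCongr hd)

/-- The block that contains an index. -/
def block (hd : ∑ i, P i = d) (k : Fin d) : Fin r := ((blockEquiv hd).symm k).1

theorem block_blockEquiv (hd : ∑ i, P i = d) (s : Σ i, Fin (P i)) :
    block hd (blockEquiv hd s) = s.1 := by
  simp [block]

theorem sum_castLE_eq (P : Fin r → ℕ) (a : Fin r) :
    ∑ j : Fin a, P (Fin.castLE a.2.le j) = ∑ j ∈ Finset.Iio a, P j := by
  refine Finset.sum_bij (fun j _ => Fin.castLE a.2.le j) ?_ ?_ ?_ ?_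
  · intro j _
    exact Finset.mem_Iio.2 j.2
  · intro j _ k _ h
    exact Fin.castLE_injective _ h
  · intro j hj
    have h : j < a := Finset.mem_Iio.1 hj
    exact ⟨⟨j, h⟩, Finset.mem_univ _, rfl⟩
  · intro j _
    rfl

theorem sum_Iic_eq (P : Fin r → ℕ) (a : Fin r) :
    ∑ j ∈ Finset.Iic a, P j = ∑ j ∈ Finset.Iio a, P j + P a := by
  rw [← Finset.Iio_insert, Finset.sum_insert (by simp), add_comm]

theorem lt_sum_Iic_iff (hd : ∑ i, P i = d) (k : Fin d) (i : Fin r) :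
    (k : ℕ) < ∑ j ∈ Finset.Iic i, P j ↔ block hd k ≤ i := by
  obtain ⟨⟨a, m⟩, rfl⟩ := (blockEquiv hd).surjective k
  rw [block_blockEquiv]
  have hval : ((blockEquiv hd ⟨a, m⟩ : Fin d) : ℕ) = ∑ j ∈ Finset.Iio a, P j + m := by
    rw [← sum_castLE_eq]
    exact finSigmaFinEquiv_apply _
  rw [hval]
  constructor
  · intro h
    by_contra hia
    have : ∑ j ∈ Finset.Iic i, P j ≤ ∑ j ∈ Finset.Iio a, P j :=
      Finset.sum_le_sum_of_subset fun j hj =>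
        Finset.mem_Iio.2 ((Finset.mem_Iic.1 hj).trans_lt (not_le.1 hia))
    omega
  · intro h
    have : ∑ j ∈ Finset.Iic a, P j ≤ ∑ j ∈ Finset.Iic i, P j :=
      Finset.sum_le_sum_of_subset (Finset.Iic_subset_Iic.2 h)
    rw [sum_Iic_eq] at this
    have := m.2
    omega

/-- The indices of a block. -/
def blockFiberEquiv (hd : ∑ i, P i = d) (i : Fin r) : {k // block hd k = i} ≃ Fin (P i) :=
  ((blockEquiv hd).symm.subtypeEquiv (q := fun s => s.1 = i) fun _ => Iff.rfl).trans
    (Equiv.sigmaSubtype i)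

theorem card_GL_block (F : Type*) [Field F] (hd : ∑ i, P i = d) (i : Fin r) :
    Nat.card (GL {k // block hd k = i} F) = Nat.card (GL (Fin (P i)) F) :=
  Nat.card_congr (Units.mapEquiv
    (reindexAlgEquiv F F (blockFiberEquiv hd i)).toMulEquiv).toEquiv

/-- The number of positions strictly above the diagonal blocks. -/
theorem two_mul_card_block_lt (hd : ∑ i, P i = d) :
    2 * Nat.card {x : Fin d × Fin d // block hd x.1 < block hd x.2} + ∑ i, P i ^ 2 = d ^ 2 := by
  classical
  let b := block hd
  have h1 : Nat.card {x : Fin d × Fin d // b x.1 < b x.2} =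
      (Finset.univ.filter fun x : Fin d × Fin d => b x.1 < b x.2).card := by
    rw [Nat.card_eq_fintype_card, Fintype.card_subtype]
  have h2 : (Finset.univ.filter fun x : Fin d × Fin d => b x.2 < b x.1).card =
      (Finset.univ.filter fun x : Fin d × Fin d => b x.1 < b x.2).card :=
    Finset.card_equiv (Equiv.prodComm _ _) (by simp)
  have h3 : (Finset.univ.filter fun x : Fin d × Fin d => b x.1 = b x.2).card = ∑ i, P i ^ 2 := by
    rw [Finset.card_eq_sum_card_fiberwise (f := fun x => b x.1) (t := Finset.univ) (by simp)]
    refine Finset.sum_congr rfl fun i _ => ?_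
    have : (Finset.univ.filter fun x : Fin d × Fin d => b x.1 = b x.2).filter
        (fun x => b x.1 = i) =
        (Finset.univ.filter fun k => b k = i) ×ˢ (Finset.univ.filter fun k => b k = i) := by
      ext x
      simp only [Finset.mem_filter, Finset.mem_univ, true_and, Finset.mem_product]
      constructor
      · rintro ⟨h, rfl⟩
        exact ⟨rfl, h.symm⟩
      · rintro ⟨h, h'⟩
        exact ⟨h.trans h'.symm, h⟩
    rw [this, Finset.card_product, ← Fintype.card_subtype,
      Fintype.card_congr (blockFiberEquiv hd i), Fintype.card_fin, sq]
  have h4 : (Finset.univ : Finset (Fin d × Fin d)).card = d ^ 2 := by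
    simp [sq]
  rw [h1, ← h3, ← h4, two_mul]
  nth_rewrite 1 [← h2]
  rw [← Finset.card_filter_add_card_filter_not (s := Finset.univ)
      (fun x : Fin d × Fin d => b x.1 = b x.2), add_comm]
  congr 1
  rw [← Finset.card_union_of_disjoint]
  · congr 1
    ext x
    simp only [Finset.mem_union, Finset.mem_filter, Finset.mem_univ, true_and]
    exact ⟨fun h => h.elim ne_of_gt ne_of_lt, fun h => (lt_or_gt_of_ne h).symm⟩
  · exact Finset.disjoint_filter.2 fun x _ h h' => h.asymm h'

end Block

/-! ### Flags and their stabilizers -/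

section Flags

variable {F : Type*} [Field F] {d r : ℕ} {P : Fin r → ℕ}

theorem Flag.ext_of_le {x y : Flag F d P} (h : ∀ i, x.space i ≤ y.space i) : x = y :=
  Flag.ext (funext fun i => Submodule.eq_of_le_of_finrank_eq (h i)
    ((x.finrank_space i).trans (y.finrank_space i).symm))

theorem smul_eq_iff (g : GL (Fin d) F) (x y : Flag F d P) :
    g • x = y ↔ ∀ i, ∀ v ∈ x.space i, (g : Matrix (Fin d) (Fin d) F) *ᵥ v ∈ y.space i := by
  constructor
  · rintro rfl i v hv
    exact Submodule.mem_map_of_mem hv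
  · intro h
    exact Flag.ext_of_le fun i => Submodule.map_le_iff_le_comap.2 (h i)

theorem mem_standardFlag_iff (hd : ∑ i, P i = d) (i : Fin r) (v : Fin d → F) :
    v ∈ (standardFlag F d P hd).space i ↔ ∀ k, i < block hd k → v k = 0 := by
  have h1 : (fun k : Fin d => (Pi.single k 1 : Fin d → F)) = Pi.basisFun F (Fin d) :=
    funext fun k => (Pi.basisFun_apply F (Fin d) k).symm
  change v ∈ Submodule.span F (_ '' _) ↔ _
  rw [h1, Module.Basis.mem_span_image]
  constructor
  · intro h k hk
    by_contra h0
    have := h (show k ∈ ((Pi.basisFun F (Fin d)).repr v).support by simpa using h0)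
    exact absurd ((lt_sum_Iic_iff hd k i).1 this) (not_le.2 hk)
  · intro h k hk
    refine (lt_sum_Iic_iff hd k i).2 (not_lt.1 fun h0 => ?_)
    have : v k ≠ 0 := by simpa using hk
    exact this (h k h0)

theorem smul_standardFlag_eq_iff (hd : ∑ i, P i = d) (g : GL (Fin d) F) (x : Flag F d P) :
    g • standardFlag F d P hd = x ↔ ∀ k, (g : Matrix (Fin d) (Fin d) F).col k ∈
      x.space (block hd k) := by
  rw [smul_eq_iff]
  constructor
  · intro h k
    rw [← mulVec_single_one]
    refine h _ _ ((mem_standardFlag_iff hd _ _).2 fun l hl => ?_)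
    exact Pi.single_eq_of_ne (fun e => hl.ne (by rw [e])) _
  · intro h i v hv
    rw [mem_standardFlag_iff] at hv
    rw [mulVec_eq_sum]
    refine Submodule.sum_mem _ fun k _ => ?_
    by_cases hk : i < block hd k
    · rw [hv k hk]
      simp
    · rw [op_smul_eq_smul]
      exact Submodule.smul_mem _ _ (x.mono (not_lt.1 hk) (h k))

theorem smul_standardFlag_eq_self_iff (hd : ∑ i, P i = d) (g : GL (Fin d) F) :
    g • standardFlag F d P hd = standardFlag F d P hd ↔
      (g : Matrix (Fin d) (Fin d) F).BlockTriangular (block hd) := by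
  rw [smul_standardFlag_eq_iff]
  simp only [mem_standardFlag_iff]
  exact ⟨fun h k l hkl => h l k hkl, fun h l k hkl => h hkl⟩

/-- A complement, within each member of a flag, of the join of the smaller members. -/
theorem Flag.exists_complement (x : Flag F d P) (i : Fin r) :
    ∃ C : Submodule F (Fin d → F), Module.finrank F C = P i ∧ C ≤ x.space i ∧
      x.space i ≤ (⨆ j : Set.Iio i, x.space j) ⊔ C := by
  have hle : (⨆ j : Set.Iio i, x.space j) ≤ x.space i := iSup_le fun j => x.mono j.2.le
  have hrank : Module.finrank F (⨆ j : Set.Iio i, x.space j : Submodule F (Fin d → F)) =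
      ∑ j ∈ Finset.Iio i, P j := by
    by_cases hi : ∃ j, j ⋖ i
    · -- The predecessor `j` of `i`: the smaller members of the flag lie in the `j`-th one.
      obtain ⟨j, hj⟩ := hi
      have h1 : (⨆ k : Set.Iio i, x.space k) = x.space j :=
        le_antisymm (iSup_le fun k => x.mono (not_lt.1 fun h => hj.2 h k.2))
          (le_iSup (fun k : Set.Iio i => x.space k) ⟨j, hj.1⟩)
      rw [h1, x.finrank_space]
      congr 1
      ext k
      simp only [Finset.mem_Iic, Finset.mem_Iio]
      exact ⟨fun h => h.trans_lt hj.1, fun h => not_lt.1 fun h' => hj.2 h' h⟩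
    · have h0 : ∀ j, ¬ j < i := fun j hj => by
        obtain ⟨k, _, hk⟩ := exists_le_covBy_of_lt hj
        exact hi ⟨k, hk⟩
      have h1 : (⨆ k : Set.Iio i, x.space k) = ⊥ := by
        refine iSup_eq_bot.2 fun k => absurd k.2 (h0 _)
      rw [h1, finrank_bot, Finset.sum_eq_zero]
      exact fun j hj => absurd (Finset.mem_Iio.1 hj) (h0 j)
  obtain ⟨C, hdis, hC⟩ := IsModularLattice.exists_disjoint_and_sup_eq hle
  refine ⟨C, ?_, hC ▸ le_sup_right, hC.ge⟩
  have h2 := Submodule.finrank_sup_add_finrank_inf_eq (⨆ j : Set.Iio i, x.space j) C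
  rw [hC, hdis.eq_bot, finrank_bot, hrank, x.finrank_space, sum_Iic_eq] at h2
  omega

/-- Every flag has an adapted basis: `GL_d(F)` acts transitively on flags. -/
theorem exists_smul_standardFlag_eq (hd : ∑ i, P i = d) (x : Flag F d P) :
    ∃ g : GL (Fin d) F, g • standardFlag F d P hd = x := by
  choose C hC hCx hxC using x.exists_complement
  let B : ∀ i, Module.Basis (Fin (P i)) F (C i) := fun i => Module.finBasisOfFinrankEq F (C i) (hC i)
  let f : (Σ i, Fin (P i)) → Fin d → F := fun s => B s.1 s.2
  have hspan : ∀ i, x.space i ≤ Submodule.span F (Set.range f) := by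
    intro i
    induction i using WellFoundedLT.induction with
    | ind i ih =>
      refine (hxC i).trans (sup_le (iSup_le fun j => ih j j.2) fun v hv => ?_)
      have h := congrArg (Submodule.subtype (C i)) ((B i).sum_repr ⟨v, hv⟩)
      rw [map_sum] at h
      change _ = v at h
      rw [← h]
      refine Submodule.sum_mem _ fun m _ => ?_
      rw [map_smul]
      exact Submodule.smul_mem _ _ (Submodule.subset_span ⟨⟨i, m⟩, rfl⟩)
  have htop : ⊤ ≤ Submodule.span F (Set.range f) := by
    rcases r with _ | r
    · -- The empty flag has no last member, but then `d = 0`.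
      have : d = 0 := by simpa using hd.symm
      subst this
      intro v _
      rw [Subsingleton.elim v 0]
      exact zero_mem _
    · refine le_trans (ge_of_eq ?_) (hspan (Fin.last r))
      refine Submodule.eq_top_of_finrank_eq ?_
      rw [x.finrank_space, Module.finrank_fin_fun, ← hd]
      congr 1
      ext j
      simp [Fin.le_last]
  have hli : LinearIndependent F f := linearIndependent_of_top_le_span_of_card_eq_finrank htop (by
    rw [Fintype.card_congr (blockEquiv hd), Fintype.card_fin, Module.finrank_fin_fun])
  let M : Matrix (Fin d) (Fin d) F := of fun k l => f ((blockEquiv hd).symm l) k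
  have hM : IsUnit M := linearIndependent_cols_iff_isUnit.1
    (hli.comp _ (blockEquiv hd).symm.injective)
  refine ⟨hM.unit, (smul_standardFlag_eq_iff hd _ _).2 fun k => ?_⟩
  exact hCx _ (B ((blockEquiv hd).symm k).1 ((blockEquiv hd).symm k).2).2

end Flags

/-! ### Frames and the weighing matrix -/

section FlagMatrix

variable {F : Type*} [Field F] {d r : ℕ} {P : Fin r → ℕ}

/-- A chosen basis adapted to a flag, as the columns of a matrix that carries the standard flag to
the given one. -/
def frame (hd : ∑ i, P i = d) (x : Flag F d P) : GL (Fin d) F :=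
  (exists_smul_standardFlag_eq hd x).choose

theorem frame_smul (hd : ∑ i, P i = d) (x : Flag F d P) :
    frame hd x • standardFlag F d P hd = x :=
  (exists_smul_standardFlag_eq hd x).choose_spec

theorem frame_inv_smul (hd : ∑ i, P i = d) (x : Flag F d P) :
    (frame hd x)⁻¹ • x = standardFlag F d P hd := by
  rw [inv_smul_eq_iff, frame_smul]

/-- The block triangular matrix by which `g` carries the frame of `x` to the frame of `g • x`. -/
def transition (hd : ∑ i, P i = d) (g : GL (Fin d) F) (x : Flag F d P) : GL (Fin d) F :=
  (frame hd (g • x))⁻¹ * g * frame hd x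

theorem transition_blockTriangular (hd : ∑ i, P i = d) (g : GL (Fin d) F) (x : Flag F d P) :
    (transition hd g x : Matrix (Fin d) (Fin d) F).BlockTriangular (block hd) := by
  rw [← smul_standardFlag_eq_self_iff, transition, mul_smul, mul_smul, frame_smul, frame_inv_smul]

/-- The product of the values of a character at the leading block minors. On invertible block
triangular matrices it is a linear character of the parabolic subgroup; its restrictions to the
diagonal blocks are powers of `χ ∘ det` whose exponents `r, r - 1, …, 1` are distinct modulo `n`
as soon as `r ≤ n`. -/
def minorChar (hd : ∑ i, P i = d) (χ : MulChar F ℂ) (M : Matrix (Fin d) (Fin d) F) : ℂ :=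
  ∏ i, χ (leadingMinor (block hd) M i)

theorem minorChar_ne_zero_iff (hd : ∑ i, P i = d) (χ : MulChar F ℂ)
    (M : Matrix (Fin d) (Fin d) F) :
    minorChar hd χ M ≠ 0 ↔ ∀ i, leadingMinor (block hd) M i ≠ 0 := by
  rw [minorChar, Finset.prod_ne_zero_iff]
  refine forall_congr' fun i => ?_
  simp only [Finset.mem_univ, true_implies]
  constructor
  · intro h h0
    exact h (by rw [h0, χ.map_zero])
  · intro h
    exact (h.isUnit.map χ).ne_zero

theorem minorChar_transition_ne_zero (hd : ∑ i, P i = d) (χ : MulChar F ℂ) (g : GL (Fin d) F)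
    (x : Flag F d P) : minorChar hd χ (transition hd g x) ≠ 0 :=
  (minorChar_ne_zero_iff hd χ _).2 fun i =>
    leadingMinor_ne_zero (transition_blockTriangular hd g x) i

theorem minorChar_pow_eq_one (hd : ∑ i, P i = d) {χ : MulChar F ℂ} {n : ℕ} (hχ : χ ^ n = 1)
    {M : Matrix (Fin d) (Fin d) F} (h : minorChar hd χ M ≠ 0) : minorChar hd χ M ^ n = 1 := by
  rw [minorChar_ne_zero_iff] at h
  rw [minorChar, ← Finset.prod_pow]
  refine Finset.prod_eq_one fun i _ => ?_
  have h1 := MulChar.one_apply (R' := ℂ) (h i).isUnit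
  rwa [← hχ, ← (h i).isUnit.unit_spec, MulChar.pow_apply_coe] at h1

theorem minorChar_transpose_mul_mul (hd : ∑ i, P i = d) (χ : MulChar F ℂ)
    {p p' : Matrix (Fin d) (Fin d) F} (hp : p.BlockTriangular (block hd))
    (hp' : p'.BlockTriangular (block hd)) (M : Matrix (Fin d) (Fin d) F) :
    minorChar hd χ (pᵀ * M * p') = minorChar hd χ p * minorChar hd χ p' * minorChar hd χ M := by
  simp only [minorChar, ← Finset.prod_mul_distrib]
  refine Finset.prod_congr rfl fun i _ => ?_
  rw [leadingMinor_mul _ _ hp', leadingMinor_transpose_mul _ hp, map_mul, map_mul]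
  ring

theorem transpose_frame_mul_frame (hd : ∑ i, P i = d) (g : GL (Fin d) F) (x y : Flag F d P) :
    (frame hd x : Matrix (Fin d) (Fin d) F)ᵀ * (frame hd y : Matrix (Fin d) (Fin d) F) =
      (transition hd g x : Matrix (Fin d) (Fin d) F)ᵀ *
        ((frame hd (g • x) : Matrix (Fin d) (Fin d) F)ᵀ *
          (frame hd (contragredient F d g • y) : Matrix (Fin d) (Fin d) F)) *
        (transition hd (contragredient F d g) y : Matrix (Fin d) (Fin d) F) := by
  have hx : frame hd x = g⁻¹ * frame hd (g • x) * transition hd g x := by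
    simp only [transition]
    group
  have hy : frame hd y = (contragredient F d g)⁻¹ * frame hd (contragredient F d g • y) *
      transition hd (contragredient F d g) y := by
    simp only [transition, mul_assoc, mul_inv_cancel_left, inv_mul_cancel_left]
  have hg : ((g⁻¹ : GL (Fin d) F) : Matrix (Fin d) (Fin d) F)ᵀ *
      (((contragredient F d g)⁻¹ : GL (Fin d) F) : Matrix (Fin d) (Fin d) F) = 1 :=
    Units.mul_inv (contragredient F d g)
  conv_lhs => rw [hx, hy]
  simp only [Units.val_mul, transpose_mul, Matrix.mul_assoc]
  rw [← Matrix.mul_assoc (((g⁻¹ : GL (Fin d) F) : Matrix (Fin d) (Fin d) F)ᵀ), hg,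
    Matrix.one_mul]

theorem minorChar_transpose_frame_mul_frame (hd : ∑ i, P i = d) (χ : MulChar F ℂ)
    (g : GL (Fin d) F) (x y : Flag F d P) :
    minorChar hd χ
        ((frame hd x : Matrix (Fin d) (Fin d) F)ᵀ * (frame hd y : Matrix (Fin d) (Fin d) F)) =
      minorChar hd χ (transition hd g x) * minorChar hd χ (transition hd (contragredient F d g) y) *
        minorChar hd χ ((frame hd (g • x) : Matrix (Fin d) (Fin d) F)ᵀ *
          (frame hd (contragredient F d g • y) : Matrix (Fin d) (Fin d) F)) := by
  rw [transpose_frame_mul_frame hd g, minorChar_transpose_mul_mul hd χ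
    (transition_blockTriangular hd g x) (transition_blockTriangular hd (contragredient F d g) y)]

/-- The weighing matrix: the character of the leading block minors of the pairing between the
frames of two flags. -/
def flagMatrix (hd : ∑ i, P i = d) (χ : MulChar F ℂ) :
    Matrix (Flag F d P) (DualFlag F d P) ℂ :=
  of fun x y => minorChar hd χ
    ((frame hd x : Matrix (Fin d) (Fin d) F)ᵀ * (frame (P := P) hd y : Matrix (Fin d) (Fin d) F))

/-- Changing a pair of flags by `g` changes the matrix entry by a factor that depends on the row
times a factor that depends on the column. -/
theorem flagMatrix_eq_smul (hd : ∑ i, P i = d) (χ : MulChar F ℂ) (g : GL (Fin d) F)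
    (x : Flag F d P) (y : DualFlag F d P) :
    flagMatrix hd χ x y = minorChar hd χ (transition hd g x) *
      minorChar hd χ (transition (P := P) hd (contragredient F d g) y) *
        flagMatrix hd χ (g • x) (g • y) :=
  minorChar_transpose_frame_mul_frame hd χ g x y

theorem flagMatrix_smul_ne_zero_iff (hd : ∑ i, P i = d) (χ : MulChar F ℂ) (g : GL (Fin d) F)
    (x : Flag F d P) (y : DualFlag F d P) :
    flagMatrix hd χ (g • x) (g • y) ≠ 0 ↔ flagMatrix hd χ x y ≠ 0 := by
  rw [flagMatrix_eq_smul hd χ g x y]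
  have h := mul_ne_zero (minorChar_transition_ne_zero hd χ g x)
    (minorChar_transition_ne_zero (P := P) hd χ (contragredient F d g) y)
  exact ⟨fun h' => mul_ne_zero h h', right_ne_zero_of_mul⟩

/-- If the leading block minors of the pairing of two frames do not vanish, the block LU
decomposition changes the frames into dual bases. -/
theorem exists_smul_eq_of_leadingMinor_ne_zero (hd : ∑ i, P i = d) {x y : Flag F d P}
    (h : ∀ i, leadingMinor (block hd)
      ((frame hd x : Matrix (Fin d) (Fin d) F)ᵀ * (frame hd y : Matrix (Fin d) (Fin d) F)) i ≠ 0) :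
    ∃ g : GL (Fin d) F, g • standardFlag F d P hd = x ∧
      contragredient F d g • standardFlag F d P hd = y := by
  obtain ⟨p, p', hp, hp', hM⟩ := exists_blockTriangular_factorization _ h
  have hps : ∀ {p : GL (Fin d) F}, (p : Matrix (Fin d) (Fin d) F).BlockTriangular (block hd) →
      p⁻¹ • standardFlag F d P hd = standardFlag F d P hd := fun hp =>
    (smul_standardFlag_eq_self_iff hd _).2 (blockTriangular_inv hp)
  have hu : (contragredient F d (frame hd x))⁻¹ * frame hd y = (contragredient F d p)⁻¹ * p' :=
    Units.ext hM
  have hc : contragredient F d (frame hd x * p⁻¹) = frame hd y * p'⁻¹ := by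
    rw [eq_mul_inv_iff_mul_eq, map_mul, map_inv, mul_assoc, ← hu, mul_inv_cancel_left]
  refine ⟨frame hd x * p⁻¹, ?_, ?_⟩
  · rw [mul_smul, hps hp, frame_smul]
  · rw [hc, mul_smul, hps hp', frame_smul]

/-- The support of the matrix is the orbit of the pair of standard flags. -/
theorem flagMatrix_ne_zero_iff (hd : ∑ i, P i = d) (χ : MulChar F ℂ)
    (x : Flag F d P) (y : DualFlag F d P) :
    flagMatrix hd χ x y ≠ 0 ↔ (x, y) ∈
      MulAction.orbit (GL (Fin d) F) (standardFlag F d P hd, dualStandardFlag F d P hd) := by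
  constructor
  · intro h
    obtain ⟨g, hx, hy⟩ := exists_smul_eq_of_leadingMinor_ne_zero hd
      ((minorChar_ne_zero_iff hd χ _).1 h)
    exact ⟨g, Prod.ext hx hy⟩
  · rintro ⟨g, hg⟩
    obtain ⟨rfl, rfl⟩ := Prod.ext_iff.1 hg
    refine (flagMatrix_smul_ne_zero_iff hd χ g _ _).2 ((minorChar_ne_zero_iff hd χ _).2 fun i => ?_)
    have hb : (frame hd (standardFlag F d P hd) : Matrix (Fin d) (Fin d) F).BlockTriangular
        (block hd) := (smul_standardFlag_eq_self_iff hd _).1 (frame_smul hd _)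
    exact (leadingMinor_transpose_mul _ hb _ i).trans_ne
      (mul_ne_zero (leadingMinor_ne_zero hb i) (leadingMinor_ne_zero hb i))

/-! ### Orthogonality of distinct rows -/

/-- The linear map that multiplies `v` by `t` and fixes the kernel of `w`, where `w ⬝ᵥ v = 1`,
fixes every flag whose members contain `v` from level `i` on and lie in the kernel of `w` before
that level. -/
theorem dilation_smul_eq (hd : ∑ i, P i = d) {v w : Fin d → F} (hwv : w ⬝ᵥ v = 1) {t : F}
    {g : GL (Fin d) F} (hg : (g : Matrix (Fin d) (Fin d) F) = 1 + vecMulVec ((t - 1) • v) w)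
    {x : Flag F d P} {i : Fin r} (hv : ∀ j, i ≤ j → v ∈ x.space j)
    (hw : ∀ j < i, ∀ u ∈ x.space j, w ⬝ᵥ u = 0) :
    g • x = x ∧ ∀ j, leadingMinor (block hd) (transition hd g x : Matrix (Fin d) (Fin d) F) j =
      if i ≤ j then t else 1 := by
  have hgx : g • x = x := by
    rw [smul_eq_iff]
    intro j u hu
    rw [hg, add_mulVec, one_mulVec, vecMulVec_mulVec, op_smul_eq_smul]
    refine Submodule.add_mem _ hu ?_
    by_cases hij : i ≤ j
    · exact Submodule.smul_mem _ _ (Submodule.smul_mem _ _ (hv j hij))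
    · rw [hw j (not_le.1 hij) u hu, zero_smul]
      exact Submodule.zero_mem _
  refine ⟨hgx, fun j => ?_⟩
  set c := frame hd x with hc
  have htr : (transition hd g x : Matrix (Fin d) (Fin d) F) =
      1 + vecMulVec ((t - 1) • ((c⁻¹ : GL (Fin d) F) : Matrix (Fin d) (Fin d) F) *ᵥ v)
        (w ᵥ* (c : Matrix (Fin d) (Fin d) F)) := by
    rw [transition, hgx, ← hc, Units.val_mul, Units.val_mul, hg, Matrix.mul_add, Matrix.add_mul,
      Matrix.mul_one, Units.inv_mul, mul_vecMulVec, vecMulVec_mul, mulVec_smul]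
  rw [htr, leadingMinor_one_add_vecMulVec]
  split_ifs with hij
  · have hz : ∀ k, j < block hd k →
        (((c⁻¹ : GL (Fin d) F) : Matrix (Fin d) (Fin d) F) *ᵥ v) k = 0 :=
      (mem_standardFlag_iff hd j _).1
        ((smul_eq_iff _ _ _).1 (frame_inv_smul hd x) j v (hv j hij))
    rw [Finset.sum_filter_of_ne]
    · change 1 + (w ᵥ* (c : Matrix (Fin d) (Fin d) F)) ⬝ᵥ
        ((t - 1) • ((c⁻¹ : GL (Fin d) F) : Matrix (Fin d) (Fin d) F) *ᵥ v) = t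
      rw [dotProduct_smul, ← dotProduct_mulVec, mulVec_mulVec, Units.mul_inv, one_mulVec, hwv]
      simp
    · intro k _ hk
      by_contra hjk
      exact hk (by rw [Pi.smul_apply, hz k (not_le.1 hjk), smul_zero, mul_zero])
  · rw [Finset.sum_eq_zero, add_zero]
    intro k hk
    have hcol : (c : Matrix (Fin d) (Fin d) F).col k ∈ x.space j :=
      x.mono (Finset.mem_filter.1 hk).2
        ((smul_standardFlag_eq_iff hd c x).1 (frame_smul hd x) k)
    have : (w ᵥ* (c : Matrix (Fin d) (Fin d) F)) k = 0 := hw j (not_le.1 hij) _ hcol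
    rw [this, zero_mul]

/-- Two distinct flags are separated by dilations: at the first level `i` where they differ, a
vector `v` of the first flag is missing from the second one, which acquires it at a later level
`a`. -/
theorem exists_dilation (hd : ∑ i, P i = d) {x x' : Flag F d P} (hx : x ≠ x') :
    ∃ i a : Fin r, i < a ∧ ∀ t : Fˣ, ∃ g : GL (Fin d) F, g • x = x ∧ g • x' = x' ∧
      (∀ j, leadingMinor (block hd) (transition hd g x : Matrix (Fin d) (Fin d) F) j =
        if i ≤ j then (t : F) else 1) ∧
      (∀ j, leadingMinor (block hd) (transition hd g x' : Matrix (Fin d) (Fin d) F) j =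
        if a ≤ j then (t : F) else 1) := by
  have h1 : ∃ i, ¬ x.space i ≤ x'.space i := by
    by_contra! h
    exact hx (Flag.ext_of_le h)
  obtain ⟨i, hi, hmin⟩ := WellFounded.has_min (wellFounded_lt (α := Fin r))
    {i | ¬ x.space i ≤ x'.space i} h1
  have heq : ∀ j < i, x.space j = x'.space j := fun j hj =>
    Submodule.eq_of_le_of_finrank_eq (not_not.1 fun h => hmin j h hj)
      ((x.finrank_space j).trans (x'.finrank_space j).symm)
  obtain ⟨v, hv, hv'⟩ := Set.not_subset.1 hi
  have h2 : ∃ a, v ∈ x'.space a := by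
    obtain ⟨r, rfl⟩ : ∃ s, r = s + 1 := Nat.exists_eq_succ_of_ne_zero (Fin.pos i).ne'
    refine ⟨Fin.last r, ?_⟩
    have : x'.space (Fin.last r) = ⊤ := by
      refine Submodule.eq_top_of_finrank_eq ?_
      rw [x'.finrank_space, Module.finrank_fin_fun, ← hd]
      congr 1
      ext j
      simp [Fin.le_last]
    rw [this]
    exact Submodule.mem_top
  obtain ⟨a, ha, hamin⟩ := WellFounded.has_min (wellFounded_lt (α := Fin r))
    {a | v ∈ x'.space a} h2
  have hia : i < a := not_le.1 fun h => hv' (x'.mono h ha)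
  -- `x'.space b`, with `b` the predecessor of `a`, contains the members of `x` before level `i` and
  -- those of `x'` before level `a`, but not `v`.
  obtain ⟨b, hib, hba⟩ := exists_le_covBy_of_lt hia
  have hvb : v ∉ x'.space b := fun h => hamin b h hba.1
  obtain ⟨f, hfv, hf⟩ := Submodule.exists_le_ker_of_notMem hvb
  let w : Fin d → F := fun k => (f v)⁻¹ * f (Pi.single k 1)
  have hw : ∀ u, w ⬝ᵥ u = (f v)⁻¹ * f u := by
    intro u
    conv_rhs => rw [pi_eq_sum_univ' u, map_sum]
    rw [dotProduct, Finset.mul_sum]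
    refine Finset.sum_congr rfl fun k _ => ?_
    rw [map_smul, smul_eq_mul]
    ring
  have hwv : w ⬝ᵥ v = 1 := by rw [hw, inv_mul_cancel₀ hfv]
  have hwb : ∀ u ∈ x'.space b, w ⬝ᵥ u = 0 := fun u hu => by
    rw [hw, LinearMap.mem_ker.1 (hf hu), mul_zero]
  refine ⟨i, a, hia, fun t => ?_⟩
  let g : GL (Fin d) F := GeneralLinearGroup.mkOfDetNeZero (1 + vecMulVec (((t : F) - 1) • v) w) (by
    rw [vecMulVec_eq Unit, det_one_add_replicateCol_mul_replicateRow, dotProduct_smul, hwv]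
    simp)
  have hA := dilation_smul_eq hd hwv (g := g) rfl (x := x) (i := i) (fun j hj => x.mono hj hv)
    (fun j hj u hu => hwb u (x'.mono (hj.le.trans hib) (heq j hj ▸ hu)))
  have hB := dilation_smul_eq hd hwv (g := g) rfl (x := x') (i := a) (fun j hj => x'.mono hj ha)
    (fun j hj u hu => hwb u (x'.mono (not_lt.1 fun h => hba.2 h hj) hu))
  exact ⟨g, hA.1, hB.1, hA.2, hB.2⟩

theorem prod_ite_le_eq_pow {z : ℂ} (i : Fin r) :
    ∏ j, (if i ≤ j then z else 1) = z ^ (r - (i : ℕ)) := by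
  rw [Finset.prod_ite, Finset.prod_const_one, mul_one, Finset.prod_const]
  congr 1
  have : (Finset.univ.filter fun j => i ≤ j) = Finset.Ici i := by
    ext
    simp
  rw [this, Fin.card_Ici]

theorem norm_minorChar (hd : ∑ i, P i = d) {χ : MulChar F ℂ} {n : ℕ} (hn : n ≠ 0)
    (hχ : χ ^ n = 1) {M : Matrix (Fin d) (Fin d) F} (h : minorChar hd χ M ≠ 0) :
    ‖minorChar hd χ M‖ = 1 :=
  Complex.norm_eq_one_of_pow_eq_one (minorChar_pow_eq_one hd hχ h) hn

/-- Distinct rows are orthogonal: reindexing their inner product by a dilation that fixes both flags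
shows that it equals itself times `χ t ^ (r - i)` times the conjugate of `χ t ^ (r - a)`, where
`0 < a - i < orderOf χ`. -/
theorem flagMatrix_row_orthogonal [Fintype F] (hd : ∑ i, P i = d) {χ : MulChar F ℂ}
    (hr : r ≤ orderOf χ) (hn : orderOf χ ≠ 0) {x x' : Flag F d P} (hx : x ≠ x') :
    ∑ y, flagMatrix hd χ x y * star (flagMatrix hd χ x' y) = 0 := by
  obtain ⟨i, a, hia, h⟩ := exists_dilation hd hx
  have hne : χ ^ ((a : ℕ) - (i : ℕ)) ≠ 1 :=
    pow_ne_one_of_lt_orderOf (Nat.sub_pos_of_lt hia).ne'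
      (lt_of_lt_of_le (by omega) hr)
  obtain ⟨t, ht⟩ := MulChar.ne_one_iff.1 hne
  rw [MulChar.pow_apply_coe] at ht
  obtain ⟨g, hgx, hgx', hm, hm'⟩ := h t
  have hmx : minorChar hd χ (transition hd g x : Matrix (Fin d) (Fin d) F) =
      χ t ^ (r - (i : ℕ)) := by
    rw [minorChar, ← prod_ite_le_eq_pow]
    refine Finset.prod_congr rfl fun j _ => ?_
    rw [hm, apply_ite χ, map_one]
  have hmx' : minorChar hd χ (transition hd g x' : Matrix (Fin d) (Fin d) F) =
      χ t ^ (r - (a : ℕ)) := by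
    rw [minorChar, ← prod_ite_le_eq_pow]
    refine Finset.prod_congr rfl fun j _ => ?_
    rw [hm', apply_ite χ, map_one]
  have hstar : ∀ {z : ℂ}, ‖z‖ = 1 → z * star z = 1 := fun {z} hz => by
    rw [Complex.star_def, Complex.mul_conj, Complex.normSq_eq_norm_sq, hz]
    simp
  have hχ := pow_orderOf_eq_one χ
  have hterm : ∀ y, flagMatrix hd χ x y * star (flagMatrix hd χ x' y) =
      (χ t ^ (r - (i : ℕ)) * star (χ t ^ (r - (a : ℕ)))) *
        (flagMatrix hd χ x (g • y) * star (flagMatrix hd χ x' (g • y))) := by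
    intro y
    have h1 := flagMatrix_eq_smul hd χ g x y
    have h2 := flagMatrix_eq_smul hd χ g x' y
    have h3 := hstar (norm_minorChar hd hn hχ
      (minorChar_transition_ne_zero (P := P) hd χ (contragredient F d g) y))
    rw [hgx, hmx] at h1
    rw [hgx', hmx'] at h2
    rw [h1, h2, star_mul', star_mul']
    linear_combination (χ t ^ (r - (i : ℕ)) * star (χ t ^ (r - (a : ℕ))) *
        (flagMatrix hd χ x (g • y) * star (flagMatrix hd χ x' (g • y)))) * h3
  have hsum : ∑ y, flagMatrix hd χ x y * star (flagMatrix hd χ x' y) =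
      (χ t ^ (r - (i : ℕ)) * star (χ t ^ (r - (a : ℕ)))) *
        ∑ y, flagMatrix hd χ x y * star (flagMatrix hd χ x' y) := by
    conv_lhs => rw [Finset.sum_congr rfl fun y _ => hterm y, ← Finset.mul_sum]
    exact congrArg (_ * ·) (Equiv.sum_comp (MulAction.toPerm g)
      (fun y => flagMatrix hd χ x y * star (flagMatrix hd χ x' y)))
  by_contra hS
  have hone : χ t ^ (r - (i : ℕ)) * star (χ t ^ (r - (a : ℕ))) = 1 :=
    (mul_right_cancel₀ hS ((one_mul _).trans hsum)).symm
  refine ht ?_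
  have hnorm : ‖χ t‖ = 1 := by
    refine Complex.norm_eq_one_of_pow_eq_one (n := orderOf χ) ?_ hn
    rw [← MulChar.pow_apply_coe, hχ, MulChar.one_apply_coe]
  have hsplit : r - (i : ℕ) = (a - i) + (r - a) := by
    have := a.2
    omega
  rw [hsplit, pow_add, mul_assoc, hstar (by rw [norm_pow, hnorm, one_pow]), mul_one] at hone
  exact hone

end FlagMatrix

/-! ### Counting flags and opposite pairs -/

section Counting

variable {F : Type*} [Field F] {d r : ℕ} {P : Fin r → ℕ}

theorem contragredient_blockTriangular_iff (hd : ∑ i, P i = d) (g : GL (Fin d) F) :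
    (contragredient F d g : Matrix (Fin d) (Fin d) F).BlockTriangular (block hd) ↔
      (g : Matrix (Fin d) (Fin d) F)ᵀ.BlockTriangular (block hd) := by
  have h : (((contragredient F d g)⁻¹ : GL (Fin d) F) : Matrix (Fin d) (Fin d) F) =
    (g : Matrix (Fin d) (Fin d) F)ᵀ := rfl
  rw [← h]
  refine ⟨blockTriangular_inv, fun h => ?_⟩
  have := blockTriangular_inv h
  rwa [inv_inv] at this

theorem card_stabilizer_standardFlag [Fintype F] (hd : ∑ i, P i = d) :
    Nat.card (MulAction.stabilizer (GL (Fin d) F) (standardFlag F d P hd)) =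
      (∏ i, Nat.card (GL (Fin (P i)) F)) * Fintype.card F ^
        Nat.card {x : Fin d × Fin d // block hd x.1 < block hd x.2} := by
  have h := card_GL_supported (K := F) (block hd) (fun k l => block hd k < block hd l)
    fun _ _ h => h
  simp_rw [card_GL_block] at h
  rw [← h]
  refine Nat.card_congr (Equiv.subtypeEquivRight fun g => ?_)
  rw [MulAction.mem_stabilizer_iff, smul_standardFlag_eq_self_iff]
  exact ⟨fun h k l h1 h2 => h (lt_of_le_of_ne (not_lt.1 h2) h1.symm),
    fun h k l hkl => h k l hkl.ne' hkl.asymm⟩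

theorem card_stabilizer_standardFlag_pair [Fintype F] (hd : ∑ i, P i = d) :
    Nat.card (MulAction.stabilizer (GL (Fin d) F)
      (standardFlag F d P hd, dualStandardFlag F d P hd)) = ∏ i, Nat.card (GL (Fin (P i)) F) := by
  have h := card_GL_supported (K := F) (block hd) (fun _ _ => False) fun _ _ h => h.elim
  simp_rw [card_GL_block] at h
  have h0 : Nat.card {x : Fin d × Fin d // False} = 0 := by simp
  rw [h0, pow_zero, mul_one] at h
  rw [← h]
  refine Nat.card_congr (Equiv.subtypeEquivRight fun g => ?_)
  have h1 : g • (standardFlag F d P hd, dualStandardFlag F d P hd) =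
      (standardFlag F d P hd, dualStandardFlag F d P hd) ↔
      g • standardFlag F d P hd = standardFlag F d P hd ∧
        contragredient F d g • standardFlag F d P hd = standardFlag F d P hd := Prod.ext_iff
  rw [MulAction.mem_stabilizer_iff, h1, smul_standardFlag_eq_self_iff,
    smul_standardFlag_eq_self_iff, contragredient_blockTriangular_iff]
  constructor
  · rintro ⟨h, h'⟩ k l hkl -
    exact (lt_or_gt_of_ne hkl).elim (fun hlt => h' hlt) (fun hgt => h hgt)
  · intro h
    exact ⟨fun k l hkl => h k l hkl.ne' id, fun k l hkl => h l k hkl.ne id⟩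

theorem ncard_orbit_mul_card_stabilizer {G X : Type*} [Group G] [MulAction G X] (x : X) :
    (MulAction.orbit G x).ncard * Nat.card (MulAction.stabilizer G x) = Nat.card G := by
  rw [← MulAction.index_stabilizer, mul_comm, Subgroup.card_mul_index]

theorem smul_mem_orbit_iff {G X : Type*} [Group G] [MulAction G X] {g : G} {x z : X} :
    g • z ∈ MulAction.orbit G x ↔ z ∈ MulAction.orbit G x := by
  rw [← MulAction.orbit_eq_iff, ← MulAction.orbit_eq_iff, MulAction.orbit_smul]

theorem card_flag_mul [Fintype F] (hd : ∑ i, P i = d) :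
    Fintype.card (Flag F d P) * ((∏ i, Nat.card (GL (Fin (P i)) F)) * Fintype.card F ^
      Nat.card {x : Fin d × Fin d // block hd x.1 < block hd x.2}) = Nat.card (GL (Fin d) F) := by
  have h := ncard_orbit_mul_card_stabilizer (G := GL (Fin d) F) (standardFlag F d P hd)
  have huniv : MulAction.orbit (GL (Fin d) F) (standardFlag F d P hd) = Set.univ :=
    Set.eq_univ_of_forall fun x => exists_smul_standardFlag_eq hd x
  rwa [huniv, Set.ncard_univ, Nat.card_eq_fintype_card, card_stabilizer_standardFlag] at h

/-- Every flag is in general position to the same number of dual flags. By transitivity this is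
the ratio of the numbers of pairs in the orbit and of flags, hence the ratio of the orders of the
stabilizers of a flag and of a pair. -/
theorem card_row_orbit [Fintype F] (hd : ∑ i, P i = d) (x : Flag F d P) :
    Nat.card {y : DualFlag F d P // (x, y) ∈
      MulAction.orbit (GL (Fin d) F) (standardFlag F d P hd, dualStandardFlag F d P hd)} =
      Fintype.card F ^ Nat.card {x : Fin d × Fin d // block hd x.1 < block hd x.2} := by
  set O := MulAction.orbit (GL (Fin d) F)
    (standardFlag F d P hd, dualStandardFlag F d P hd) with hO
  have hreg : ∀ x', Nat.card {y : DualFlag F d P // (x', y) ∈ O} =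
      Nat.card {y : DualFlag F d P // (x, y) ∈ O} := by
    intro x'
    obtain ⟨g, rfl⟩ := exists_smul_standardFlag_eq hd x
    obtain ⟨g', rfl⟩ := exists_smul_standardFlag_eq hd x'
    refine Nat.card_congr ((MulAction.toPerm (g * g'⁻¹)).subtypeEquiv fun y => ?_)
    have : (g • standardFlag F d P hd, (g * g'⁻¹) • y) =
        (g * g'⁻¹) • (g' • standardFlag F d P hd, y) := by
      rw [Prod.smul_mk, mul_smul g g'⁻¹ (g' • standardFlag F d P hd), inv_smul_smul]
    rw [MulAction.toPerm_apply, this, hO, smul_mem_orbit_iff]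
  have hcount : O.ncard = Fintype.card (Flag F d P) *
      Nat.card {y : DualFlag F d P // (x, y) ∈ O} := by
    let e : O ≃ Σ x', {y : DualFlag F d P // (x', y) ∈ O} :=
      { toFun := fun z => ⟨z.1.1, z.1.2, z.2⟩
        invFun := fun z => ⟨(z.1, z.2.1), z.2.2⟩
        left_inv := fun _ => rfl
        right_inv := fun _ => rfl }
    rw [← Nat.card_coe_set_eq, Nat.card_congr e, Nat.card_sigma]
    simp [hreg]
  have h := ncard_orbit_mul_card_stabilizer (G := GL (Fin d) F)
    (standardFlag F d P hd, dualStandardFlag F d P hd)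
  rw [← hO, hcount, card_stabilizer_standardFlag_pair, ← card_flag_mul hd] at h
  have h1 : 0 < Fintype.card (Flag F d P) :=
    Fintype.card_pos_iff.2 ⟨standardFlag F d P hd⟩
  have h2 : 0 < ∏ i, Nat.card (GL (Fin (P i)) F) := Finset.prod_pos fun i _ => Nat.card_pos
  refine Nat.eq_of_mul_eq_mul_left (Nat.mul_pos h1 h2) ?_
  linarith

theorem qFactorial_succ (q m : ℕ) : qFactorial q (m + 1) = qFactorial q m * qNumber q (m + 1) :=
  Finset.prod_Icc_succ_top (by omega) _

theorem card_GL_eq_qFactorial [Fintype F] (m : ℕ) :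
    (Nat.card (GL (Fin m) F) : ℚ) = (Fintype.card F : ℚ) ^ (∑ i ∈ Finset.range m, i) *
      ((Fintype.card F : ℚ) - 1) ^ m * qFactorial (Fintype.card F) m := by
  set q := Fintype.card F with hq
  have hq1 : 1 < q := Fintype.one_lt_card
  have hq0 : (q : ℚ) - 1 ≠ 0 := sub_ne_zero.2 (by exact_mod_cast hq1.ne')
  have hfac : ∀ m, ∏ k ∈ Finset.range m, ((q : ℚ) ^ (k + 1) - 1) =
      ((q : ℚ) - 1) ^ m * qFactorial q m := by
    intro m
    induction m with
    | zero => simp [qFactorial]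
    | succ m ih =>
      rw [Finset.prod_range_succ, ih, qFactorial_succ, qNumber]
      field_simp
      ring
  rw [card_GL_field, ← hq, Nat.cast_prod, mul_assoc, ← hfac, ← Finset.prod_range_reflect,
    ← Finset.prod_pow_eq_pow_sum, ← Finset.prod_mul_distrib,
    Finset.prod_range (fun i => (q : ℚ) ^ i * ((q : ℚ) ^ (m - 1 - i + 1) - 1))]
  refine Finset.prod_congr rfl fun i _ => ?_
  have hi := i.2
  rw [Nat.cast_sub (Nat.pow_le_pow_right hq1.le hi.le), mul_sub, mul_one, ← pow_add]
  push_cast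
  congr 2
  omega

theorem card_flag_eq_qMultinomial [Fintype F] (hd : ∑ i, P i = d) :
    (Fintype.card (Flag F d P) : ℚ) = qMultinomial (Fintype.card F) d P := by
  have h := congrArg (Nat.cast (R := ℚ)) (card_flag_mul (F := F) hd)
  have hu := two_mul_card_block_lt hd
  set u := Nat.card {x : Fin d × Fin d // block hd x.1 < block hd x.2}
  push_cast at h
  simp_rw [card_GL_eq_qFactorial] at h
  set q := Fintype.card F with hq
  have hq1 : 1 < q := Fintype.one_lt_card
  have hq0 : (q : ℚ) - 1 ≠ 0 := sub_ne_zero.2 (by exact_mod_cast hq1.ne')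
  have hqq : (q : ℚ) ≠ 0 := by positivity
  have hfac : ∀ m, qFactorial q m ≠ 0 := fun m => by
    have hpos : (0 : ℚ) < (Nat.card (GL (Fin m) F) : ℚ) := by exact_mod_cast Nat.card_pos
    rw [card_GL_eq_qFactorial] at hpos
    exact right_ne_zero_of_mul hpos.ne'
  -- The powers of `q` in the orders of the linear groups and of the unipotent radical cancel.
  have hexp : ∑ i, ∑ j ∈ Finset.range (P i), j + u = ∑ j ∈ Finset.range d, j := by
    have hg : ∀ m, 2 * ∑ j ∈ Finset.range m, j + m = m ^ 2 := fun m => by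
      have := Finset.sum_range_id_mul_two m
      rcases m with _ | m
      · simp
      · rw [Nat.add_sub_cancel] at this
        linarith
    have h1 := hg d
    have h2 : 2 * ∑ i, ∑ j ∈ Finset.range (P i), j + ∑ i, P i = ∑ i, P i ^ 2 := by
      rw [Finset.mul_sum, ← Finset.sum_add_distrib]
      exact Finset.sum_congr rfl fun i _ => hg (P i)
    omega
  rw [Finset.prod_mul_distrib, Finset.prod_mul_distrib, Finset.prod_pow_eq_pow_sum,
    Finset.prod_pow_eq_pow_sum, hd, ← hexp, pow_add] at h
  rw [qMultinomial, eq_div_iff (Finset.prod_ne_zero_iff.2 fun i _ => hfac _)]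
  have hne : (q : ℚ) ^ (∑ i, ∑ j ∈ Finset.range (P i), j) * (q : ℚ) ^ u *
      ((q : ℚ) - 1) ^ d ≠ 0 := by positivity
  refine mul_left_cancel₀ hne ?_
  linear_combination h

end Counting

/-! ### The automorphisms of the weighing matrix -/

section Automorphisms

/-- The monomial matrix with entries `c j` at the positions `(σ j, j)`. -/
def monomial {S : Type*} [Fintype S] [DecidableEq S] {n : ℕ} (σ : Equiv.Perm S)
    (c : S → rootsOfUnity n ℂ) : Mon n S :=
  have h : (of fun i j => if i = σ j then ((c j : ℂˣ) : ℂ) else 0) *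
      (of fun i j => if i = σ⁻¹ j then (((c (σ⁻¹ j))⁻¹ : ℂˣ) : ℂ) else 0) = (1 : Matrix S S ℂ) := by
    ext i j
    simp [mul_apply, one_apply]
  ⟨⟨_, _, h, mul_eq_one_comm.1 h⟩, (isMonomial_iff n _).2 ⟨σ, c, fun _ _ => rfl⟩⟩

theorem absMon_monomial {S : Type*} [Fintype S] [DecidableEq S] {n : ℕ} (σ : Equiv.Perm S)
    (c : S → rootsOfUnity n ℂ) : absMon n S (monomial σ c) = σ := by
  refine Equiv.ext fun j => ?_
  refine ((underlyingFun_spec (monomial σ c) (σ j) j).1 ?_).symm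
  change (if σ j = σ j then ((c j : ℂˣ) : ℂ) else 0) ≠ 0
  simp

/-- A pair of permutations that changes the entries of `A` by a row factor times a column factor
lifts to an automorphism. -/
theorem exists_mem_Aut {X Y : Type*} [Fintype X] [DecidableEq X] [Fintype Y] [DecidableEq Y]
    {n : ℕ} {A : Matrix X Y ℂ} (σ : Equiv.Perm X) (ρ : Equiv.Perm Y)
    (a : X → rootsOfUnity n ℂ) (b : Y → rootsOfUnity n ℂ)
    (h : ∀ x y, A x y = ((a x : ℂˣ) : ℂ) * ((b y : ℂˣ) : ℂ) * A (σ x) (ρ y))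
    (hn : n ≠ 0) :
    ∃ z ∈ Aut n A, absPair n X Y z = (σ, ρ) := by
  let p : Mon n X × Mon n Y := (monomial σ fun x => (a x)⁻¹, monomial ρ b)
  refine ⟨QuotientGroup.mk' (Triv n X Y) p, ⟨p, ?_, rfl⟩,
    Prod.ext (absMon_monomial σ _) (absMon_monomial ρ b)⟩
  change (of fun i j => if i = σ j then ((((a j)⁻¹ : rootsOfUnity n ℂ) : ℂˣ) : ℂ) else 0) * A *
    (of fun i j => if i = ρ j then ((b j : ℂˣ) : ℂ) else 0)ᴴ = A
  ext i j
  obtain ⟨x, rfl⟩ := σ.surjective i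
  obtain ⟨y, rfl⟩ := ρ.surjective j
  have hb : ((b y : ℂˣ) : ℂ) * star ((b y : ℂˣ) : ℂ) = 1 := by
    have h1 : ‖((b y : ℂˣ) : ℂ)‖ = 1 := by
      refine Complex.norm_eq_one_of_pow_eq_one (n := n) ?_ hn
      rw [← Units.val_pow_eq_pow_val, (mem_rootsOfUnity n _).1 (b y).2, Units.val_one]
    rw [Complex.star_def, Complex.mul_conj, Complex.normSq_eq_norm_sq, h1]
    simp
  have ha : ((((a x)⁻¹ : rootsOfUnity n ℂ) : ℂˣ) : ℂ) * ((a x : ℂˣ) : ℂ) = 1 := by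
    simp
  have hsum : ((of fun i j => if i = σ j then ((((a j)⁻¹ : rootsOfUnity n ℂ) : ℂˣ) : ℂ) else 0) *
      A * (of fun i j => if i = ρ j then ((b j : ℂˣ) : ℂ) else 0)ᴴ) (σ x) (ρ y) =
      ((((a x)⁻¹ : rootsOfUnity n ℂ) : ℂˣ) : ℂ) * A x y * star ((b y : ℂˣ) : ℂ) := by
    simp only [mul_apply, of_apply, conjTranspose_apply, EmbeddingLike.apply_eq_iff_eq, ite_mul,
      zero_mul, apply_ite star, star_zero, mul_ite, mul_zero, Finset.sum_ite_eq, Finset.mem_univ,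
      if_true]
  rw [hsum, h x y]
  linear_combination (((b y : ℂˣ) : ℂ) * star ((b y : ℂˣ) : ℂ) * A (σ x) (ρ y)) * ha +
    A (σ x) (ρ y) * hb

end Automorphisms

/-! ### The weighing property and the symmetries -/

section GW

variable {F : Type*} [Field F] {d r : ℕ} {P : Fin r → ℕ}

theorem flagMatrix_isGW [Fintype F] (hd : ∑ i, P i = d) {χ : MulChar F ℂ} (hr : r ≤ orderOf χ)
    (hn : orderOf χ ≠ 0) :
    IsGW (Fintype.card (Flag F d P)) (Fintype.card F ^
      Nat.card {x : Fin d × Fin d // block hd x.1 < block hd x.2}) (orderOf χ)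
      (flagMatrix (P := P) hd χ) where
  weight_pos := Nat.pow_pos Fintype.card_pos
  weight_le := by
    classical
    rw [← card_row_orbit hd (standardFlag F d P hd), Nat.card_eq_fintype_card]
    exact Fintype.card_subtype_le _
  card_rows := rfl
  card_cols := rfl
  entries x y := by
    by_cases h : flagMatrix hd χ x y = 0
    · exact Or.inl h
    · refine Or.inr ⟨Units.mk0 _ h, ?_, rfl⟩
      rw [mem_rootsOfUnity]
      exact Units.ext (minorChar_pow_eq_one hd (pow_orderOf_eq_one χ) h)
  mul_conjTranspose := by
    classical
    ext x x'
    rw [mul_apply, Matrix.smul_apply, one_apply]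
    by_cases hx : x = x'
    · subst hx
      have hterm : ∀ y, flagMatrix hd χ x y * (flagMatrix hd χ)ᴴ y x =
          if (x, y) ∈ MulAction.orbit (GL (Fin d) F)
            (standardFlag F d P hd, dualStandardFlag F d P hd) then 1 else 0 := by
        intro y
        rw [conjTranspose_apply]
        split_ifs with h
        · have h1 := norm_minorChar hd hn (pow_orderOf_eq_one χ)
            ((flagMatrix_ne_zero_iff hd χ x y).2 h)
          rw [Complex.star_def, Complex.mul_conj, Complex.normSq_eq_norm_sq]
          change ((‖flagMatrix hd χ x y‖ ^ 2 : ℝ) : ℂ) = 1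
          rw [show ‖flagMatrix hd χ x y‖ = 1 from h1]
          simp
        · rw [← flagMatrix_ne_zero_iff hd χ, not_not] at h
          rw [h, zero_mul]
      rw [if_pos rfl, Finset.sum_congr rfl fun y _ => hterm y, Finset.sum_boole,
        ← card_row_orbit hd x, Nat.card_eq_fintype_card, Fintype.card_subtype]
      simp
    · rw [if_neg hx, smul_zero]
      exact flagMatrix_row_orthogonal hd hr hn hx

open Classical in
theorem charMatrix_apply {X Y : Type*} (O : Set (X × Y)) (x : X) (y : Y) :
    charMatrix O x y = if (x, y) ∈ O then 1 else 0 := by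
  rw [charMatrix, of_apply, Set.indicator_apply]

theorem absMatrix_flagMatrix (hd : ∑ i, P i = d) {χ : MulChar F ℂ} (hn : orderOf χ ≠ 0) :
    absMatrix (flagMatrix (P := P) hd χ) = charMatrix
      (MulAction.orbit (GL (Fin d) F) (standardFlag F d P hd, dualStandardFlag F d P hd)) := by
  classical
  ext x y
  rw [charMatrix_apply]
  change ‖flagMatrix hd χ x y‖ = _
  split_ifs with h
  · exact norm_minorChar hd hn (pow_orderOf_eq_one χ) ((flagMatrix_ne_zero_iff hd χ x y).2 h)
  · rw [← flagMatrix_ne_zero_iff hd χ, not_not] at h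
    rw [h, norm_zero]

/-- The value of the character at a transition matrix, as a root of unity. -/
def transitionRoot (hd : ∑ i, P i = d) (χ : MulChar F ℂ) (g : GL (Fin d) F) (x : Flag F d P) :
    rootsOfUnity (orderOf χ) ℂ :=
  ⟨Units.mk0 _ (minorChar_transition_ne_zero hd χ g x), (mem_rootsOfUnity _ _).2
    (Units.ext (minorChar_pow_eq_one hd (pow_orderOf_eq_one χ)
      (minorChar_transition_ne_zero hd χ g x)))⟩

end GW

end FlagWeighing

end

open FlagWeighing in
theorem mainTheorem4 (q : ℕ) (F : Type*) [Field F] [Fintype F] (hq : Fintype.card F = q)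
    (d r n : ℕ) (P : Fin r → ℕ) (hP : ∀ i, 0 < P i) (hd : ∑ i, P i = d)
    (hn : 1 < n) (hnq : n ∣ q - 1) (hnr : r ≤ n) :
    ∃ N u : ℕ,
      (N : ℚ) = qMultinomial q d P ∧
      (u : ℚ) = ((d : ℚ) ^ 2 - ∑ i, (P i : ℚ) ^ 2) / 2 ∧
      ∃ A : Matrix (Flag F d P) (DualFlag F d P) ℂ,
        IsGW N (q ^ u) n A ∧
        absMatrix A = charMatrix
          (MulAction.orbit (GL (Fin d) F) (standardFlag F d P hd, dualStandardFlag F d P hd)) ∧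
        ∀ σ ∈ (flagPerm F d P).range,
          σ ∈ PermAut (absMatrix A) ∧ ∃ a ∈ Aut n A, absPair n _ _ a = σ := by
  subst hq
  obtain ⟨χ, rfl⟩ := MulChar.exists_mulChar_orderOf F hnq
    (Complex.isPrimitiveRoot_exp n (by omega))
  have hn0 : orderOf χ ≠ 0 := by omega
  refine ⟨Fintype.card (Flag F d P),
    Nat.card {x : Fin d × Fin d // block hd x.1 < block hd x.2},
    card_flag_eq_qMultinomial hd, ?_, flagMatrix hd χ, flagMatrix_isGW hd hnr hn0,
    absMatrix_flagMatrix hd hn0, ?_⟩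
  · have h := congrArg (Nat.cast (R := ℚ)) (two_mul_card_block_lt hd)
    push_cast at h
    linarith
  · rintro _ ⟨g, rfl⟩
    refine ⟨fun x y => ?_, exists_mem_Aut _ _ (transitionRoot hd χ g)
      (transitionRoot (P := P) hd χ (contragredient F d g))
      (fun x y => flagMatrix_eq_smul hd χ g x y) hn0⟩
    classical
    rw [absMatrix_flagMatrix hd hn0]
    rw [charMatrix_apply, charMatrix_apply]
    exact if_congr (smul_mem_orbit_iff (g := g) (z := (x, y))) rfl rfl
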